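/- Let $H\in(0,1)$ and $\alpha\in(0,1)$. On a probability space $(\Omega,\mathcal F,P)$ let $B^H=\{B^H_t,\ t\ge 0\}$ be a fractional Brownian motion with Hurst index $H$, i.e. a centred Gaussian process with almost surely continuous paths and $\mathrm{Cov}(B^H_s,B^H_t)=\tfrac12\left(t^{2H}+s^{2H}-|t-s|^{2H}\right)$. Let $\eta^\alpha=\{\eta^\alpha_r,\ r\ge 0\}$ be an $\alpha$-stable subordinator, i.e. a process with $\eta^\alpha_0=0$ a.s., independent and stationary increments, almost surely nondecreasing right-continuous paths, and $E(e^{-u\eta^\alpha_r})=e^{-ru^\alpha}$ for all $u,r\ge 0$. Let $T^\alpha_t=\inf\{r>0:\ \eta^\alpha_r\ge t\}$, $t\ge0$, be the inverse $\alpha$-stable subordinator, and assume that the process $T^\alpha$ is independent of the process $B^H$. Then the time-changed process $X_t=B^H_{T^\alpha_t}$, $t\ge 0$, has long range dependence: every $X_t$ is centred with finite variance, and there are $d\in(0,1)$ and, for each $s>0$, a constant $c(s)\neq0$ such that for every fixed $s>0$ $$\mathrm{Corr}(X_t,X_s)\sim c(s)\,t^{-d}\qquad\text{as } t\to\infty,$$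 where $\mathrm{Corr}(U,V)=\mathrm{Cov}(U,V)/\sqrt{E(U^2)E(V^2)}$ for centred $U,V$. -/

import Mathlib

open MeasureTheory ProbabilityTheory Filter Asymptotics
open scoped NNReal

/-- Fractional Brownian motion on `[0, ∞)` with Hurst index `H`: a centred Gaussian process with
covariance `(t^{2H} + s^{2H} - |t - s|^{2H}) / 2` and almost surely continuous paths. -/
structure IsFractionalBrownianMotion {Ω : Type*} [MeasurableSpace Ω] (H : ℝ)
    (B : ℝ≥0 → Ω → ℝ) (P : Measure Ω) : Prop where
  isGaussianProcess : IsGaussianProcess B P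
  centered : ∀ t, ∫ ω, B t ω ∂P = 0
  covariance_eq : ∀ s t : ℝ≥0, cov[B s, B t; P] =
    ((t : ℝ) ^ (2 * H) + (s : ℝ) ^ (2 * H) - |(t : ℝ) - (s : ℝ)| ^ (2 * H)) / 2
  continuous_paths : ∀ᵐ ω ∂P, Continuous fun t : ℝ≥0 ↦ B t ω

/-- The `α`-stable subordinator: a Lévy process started at `0` with nondecreasing right-continuous
paths (left limits exist by monotonicity) and Laplace transform
`E (exp (-u η_r)) = exp (-r u^α)`. -/
structure IsStableSubordinator {Ω : Type*} [MeasurableSpace Ω] (α : ℝ)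
    (η : ℝ≥0 → Ω → ℝ) (P : Measure Ω) : Prop where
  measurable : ∀ r, Measurable (η r)
  start_zero : ∀ᵐ ω ∂P, η 0 ω = 0
  monotone_paths : ∀ᵐ ω ∂P, Monotone fun r : ℝ≥0 ↦ η r ω
  rightContinuous_paths :
    ∀ᵐ ω ∂P, ∀ r : ℝ≥0, ContinuousWithinAt (fun q : ℝ≥0 ↦ η q ω) (Set.Ici r) r
  indepIncrements : HasIndepIncrements η P
  stationaryIncrements : ∀ r h : ℝ≥0, IdentDistrib (η (r + h) - η r) (η h) P P
  laplace : ∀ (r : ℝ≥0) (u : ℝ), 0 ≤ u →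
    ∫ ω, Real.exp (-u * η r ω) ∂P = Real.exp (-(r : ℝ) * u ^ α)

/-- The inverse (first passage time process) `T_t = inf {r > 0 : η_r ≥ t}` of a process `η`. -/
noncomputable def inverseProcess {Ω : Type*} (η : ℝ≥0 → Ω → ℝ) (t : ℝ≥0) (ω : Ω) : ℝ≥0 :=
  sInf {r : ℝ≥0 | 0 < r ∧ (t : ℝ) ≤ η r ω}

/-- The time-changed process `X_{T_t}`. -/
def timeChange {Ω : Type*} (X : ℝ≥0 → Ω → ℝ) (T : ℝ≥0 → Ω → ℝ≥0) (t : ℝ≥0) (ω : Ω) : ℝ :=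
  X (T t ω) ω

/-- The correlation coefficient `Cov(U, V) / √(E(U²) E(V²))` of two centred random variables. -/
noncomputable def corr {Ω : Type*} [MeasurableSpace Ω] (U V : Ω → ℝ) (P : Measure Ω) : ℝ :=
  cov[U, V; P] / √((∫ ω, U ω ^ 2 ∂P) * (∫ ω, V ω ^ 2 ∂P))

/-- Long range dependence of a (not necessarily stationary) centred process with finite variance:
there is `d ∈ (0, 1)` such that for every fixed `s > 0`, `Corr(X_t, X_s) ∼ c(s) t^{-d}` as
`t → ∞`, with a nonzero constant `c(s)` depending on `s`. -/
structure HasLongRangeDependence {Ω : Type*} [MeasurableSpace Ω] (X : ℝ≥0 → Ω → ℝ)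
    (P : Measure Ω) : Prop where
  memLp_two : ∀ t, MemLp (X t) 2 P
  centered : ∀ t, ∫ ω, X t ω ∂P = 0
  corr_equivalent : ∃ d : ℝ, 0 < d ∧ d < 1 ∧ ∃ c : ℝ≥0 → ℝ, ∀ s : ℝ≥0, 0 < s →
    c s ≠ 0 ∧ (fun t : ℝ≥0 ↦ corr (X t) (X s) P) ~[atTop] fun t : ℝ≥0 ↦ c s * (t : ℝ) ^ (-d)

/-!
Write `T` for the inverse subordinator and `X` for the time-changed process. By independence,
conditioning on `T` gives, for `s ≤ t` and `p = 2H`,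
`Cov (X_t, X_s) = (E T_s ^ p + E (T_t ^ p - (T_t - T_s) ^ p)) / 2` and `E X_t ^ 2 = E T_t ^ p`
(`IsFractionalBrownianMotion.timeChange_moments`, `IsStableSubordinator.integral_fbmCov`). The
subordinator is self-similar, because a law on `[0, ∞)` is determined by its Laplace transform
(`ext_of_integral_exp_neg_nat_mul`), and passes to its inverse the scaling
`E T_t ^ q = t ^ (α q) E T_1 ^ q` (`IsStableSubordinator.integral_rpow_eq`). So only the behaviour
of `J t = E (T_t ^ p - (T_t - T_s) ^ p)` as `t → ∞` is in question.

* If `p < 1`, the integrand tends to `0` and is at most `T_s ^ p`, so `J t → 0`.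
* If `p = 1`, then `J t = E T_s`.
* If `p > 1`, a two-variable layer cake formula (`lintegral_rpow_sub_rpow_eq`) expresses `J t` as
  `p (p - 1) ∫∫ v ^ (p - 2) P (r < T_s, r + v < T_t) dv dr`. As `{r < T_s} = {η_r < s}` almost
  surely, stationary and independent increments give
  `P (r < T_s) P (v < T_{t - s}) ≤ P (r < T_s, r + v < T_t) ≤ P (r < T_s) P (v < T_t)`,
  hence `p E T_s E T_{t - s} ^ (p - 1) ≤ J t ≤ p E T_s E T_t ^ (p - 1)`, and both bounds are
  asymptotic to a positive multiple of `t ^ (α (p - 1))`. No strong Markov property is needed.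

Hence the covariance is asymptotic to a positive multiple of `t ^ (α max (p - 1) 0)`, the standard
deviation of `X_t` is a multiple of `t ^ (α H)`, and the correlation decays with exponent
`d = α H - α max (2 H - 1) 0`, that is `α min H (1 - H)`, which lies in `(0, 1)`.
-/

open scoped ENNReal Topology BoundedContinuousFunction

/-! ### Uniqueness of Laplace transforms -/

/-- The algebra of polynomials in `e^{-x}`, as bounded continuous functions on `[0, ∞)`. -/
noncomputable def expNegPolynomials : StarSubalgebra ℝ (ℝ≥0 →ᵇ ℝ) where
  carrier := {g | ∃ p : Polynomial ℝ, ∀ x : ℝ≥0, g x = p.eval (Real.exp (-(x : ℝ)))}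
  mul_mem' := by
    rintro f g ⟨p, hp⟩ ⟨q, hq⟩
    exact ⟨p * q, fun x ↦ by simp [hp, hq]⟩
  add_mem' := by
    rintro f g ⟨p, hp⟩ ⟨q, hq⟩
    exact ⟨p + q, fun x ↦ by simp [hp, hq]⟩
  algebraMap_mem' c := ⟨Polynomial.C c, fun x ↦ by simp⟩
  star_mem' := by
    rintro f ⟨p, hp⟩
    exact ⟨p, fun x ↦ by simp [hp]⟩

lemma separatesPoints_expNegPolynomials :
    (expNegPolynomials.map
      (BoundedContinuousFunction.toContinuousMapStarₐ ℝ)).SeparatesPoints := by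
  intro x y hxy
  let e : ℝ≥0 →ᵇ ℝ := BoundedContinuousFunction.ofNormedAddCommGroup
    (fun x : ℝ≥0 ↦ Real.exp (-(x : ℝ))) (by fun_prop) 1 fun x ↦ by
      rw [Real.norm_eq_abs, Real.abs_exp]
      exact Real.exp_le_one_iff.2 (by simp)
  refine ⟨e, ⟨BoundedContinuousFunction.toContinuousMapStarₐ ℝ e, ⟨e, ?_, rfl⟩, rfl⟩, ?_⟩
  · exact ⟨Polynomial.X, fun x ↦ by simp [e]⟩
  · intro h
    apply hxy
    have : Real.exp (-(x : ℝ)) = Real.exp (-(y : ℝ)) := h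
    simpa using this

/-- A finite measure on `[0, ∞)` is determined by the values of its Laplace transform at the
natural numbers: they give the integrals of all polynomials in `e^{-x}`, and these separate
points. -/
theorem ext_of_integral_exp_neg_nat_mul {μ ν : Measure ℝ≥0} [IsFiniteMeasure μ]
    [IsFiniteMeasure ν]
    (h : ∀ n : ℕ, ∫ x : ℝ≥0, Real.exp (-(n * x : ℝ)) ∂μ = ∫ x : ℝ≥0, Real.exp (-(n * x : ℝ)) ∂ν) :
    μ = ν := by
  refine ext_of_forall_mem_subalgebra_integral_eq_of_polish
    (𝕜 := ℝ) (A := expNegPolynomials) separatesPoints_expNegPolynomials ?_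
  rintro g ⟨p, hp⟩
  have key : ∀ (κ : Measure ℝ≥0) [IsFiniteMeasure κ], ∫ x, g x ∂κ
      = ∑ i ∈ p.support, p.coeff i * ∫ x : ℝ≥0, Real.exp (-(i * x : ℝ)) ∂κ := by
    intro κ _
    simp_rw [hp, Polynomial.eval_eq_sum, Polynomial.sum, ← Real.exp_nat_mul, mul_neg]
    rw [integral_finsetSum]
    · simp_rw [integral_const_mul]
    · intro i _
      refine Integrable.const_mul (Integrable.of_bound (C := 1) (by fun_prop) ?_) _
      filter_upwards with x
      rw [Real.norm_eq_abs, Real.abs_exp]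
      exact Real.exp_le_one_iff.2 (by simp; positivity)
  rw [key μ, key ν]
  simp_rw [h]

/-! ### First passage times of the stable subordinator -/

section Inverse

variable {Ω : Type*} [MeasurableSpace Ω] {P : Measure Ω} {α : ℝ}
  {η : ℝ≥0 → Ω → ℝ}

lemma IsStableSubordinator.ae_nonneg (hη : IsStableSubordinator α η P) :
    ∀ᵐ ω ∂P, ∀ r, 0 ≤ η r ω := by
  filter_upwards [hη.start_zero, hη.monotone_paths] with ω h0 hm r
  rw [← h0]
  exact hm zero_le

variable [IsProbabilityMeasure P]

/-- Chernoff bound for small values of `η_r`, from the Laplace transform at `u = 1`. -/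
lemma IsStableSubordinator.measure_lt_le (hη : IsStableSubordinator α η P) (r : ℝ≥0) (t : ℝ) :
    P {ω | η r ω < t} ≤ ENNReal.ofReal (Real.exp (t - r)) := by
  have hint : Integrable (fun ω ↦ Real.exp (-(1 : ℝ) * η r ω)) P := by
    refine Integrable.of_bound (C := 1)
      (by have := hη.measurable r; fun_prop) ?_
    filter_upwards [hη.ae_nonneg] with ω hω
    rw [Real.norm_eq_abs, Real.abs_exp]
    exact Real.exp_le_one_iff.2 (by have := hω r; linarith)
  have h1 := hη.laplace r 1 zero_le_one
  have hmk := mul_meas_ge_le_integral_of_nonneg (μ := P)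
    (Eventually.of_forall fun ω ↦ (Real.exp_pos (-(1 : ℝ) * η r ω)).le) hint (Real.exp (-t))
  rw [h1, Real.one_rpow, mul_one] at hmk
  have h2 : P.real {ω | η r ω < t} ≤ Real.exp (t - r) := by
    calc P.real {ω | η r ω < t}
        ≤ P.real {ω | Real.exp (-t) ≤ Real.exp (-(1 : ℝ) * η r ω)} := by
          refine measureReal_mono ?_
          intro ω hω
          simp only [Set.mem_ofPred_eq] at hω ⊢
          exact Real.exp_le_exp.2 (by linarith)
      _ ≤ Real.exp (t - r) := by
          have : Real.exp (t - r) = Real.exp (-r) / Real.exp (-t) := by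
            rw [← Real.exp_sub]; ring_nf
          rw [this, le_div_iff₀ (Real.exp_pos _), mul_comm]
          exact hmk
  rw [← ofReal_measureReal]
  exact ENNReal.ofReal_le_ofReal h2

/-- The paths are unbounded, so the infimum defining the passage times is never that of the empty
set. -/
lemma IsStableSubordinator.ae_exists_le (hη : IsStableSubordinator α η P) :
    ∀ᵐ ω ∂P, ∀ t : ℝ, ∃ r : ℝ≥0, 0 < r ∧ t ≤ η r ω := by
  have h : ∀ m : ℕ, ∀ᵐ ω ∂P, ∃ n : ℕ, (m : ℝ) ≤ η (n + 1) ω := by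
    intro m
    rw [ae_iff]
    simp only [not_exists, not_le]
    refine le_antisymm ?_ zero_le
    have hlim : Tendsto (fun n : ℕ ↦ ENNReal.ofReal (Real.exp (m - ((n + 1 : ℝ≥0) : ℝ)))) atTop
        (𝓝 (ENNReal.ofReal 0)) := by
      refine (ENNReal.continuous_ofReal.tendsto 0).comp ?_
      refine Real.tendsto_exp_atBot.comp ?_
      refine tendsto_atBot_add_const_left _ _ (tendsto_neg_atTop_atBot.comp ?_)
      push_cast
      exact tendsto_atTop_add_const_right _ _ tendsto_natCast_atTop_atTop
    rw [ENNReal.ofReal_zero] at hlim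
    refine ge_of_tendsto' hlim fun n ↦ ?_
    refine le_trans (measure_mono ?_) (hη.measure_lt_le (n + 1) m)
    intro ω hω
    exact hω n
  filter_upwards [ae_all_iff.2 h] with ω hω t
  obtain ⟨m, hm⟩ := exists_nat_ge t
  obtain ⟨n, hn⟩ := hω m
  exact ⟨n + 1, by positivity, hm.trans hn⟩

/-- Almost surely the passage times are the generalised inverse of the subordinator. The case `r = 0`
is included because right-continuity makes the passage times of positive levels positive. -/
lemma IsStableSubordinator.ae_lt_inverseProcess_iff (hη : IsStableSubordinator α η P) :
    ∀ᵐ ω ∂P, ∀ r t : ℝ≥0, r < inverseProcess η t ω ↔ η r ω < t := by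
  filter_upwards [hη.start_zero, hη.monotone_paths, hη.rightContinuous_paths, hη.ae_exists_le]
    with ω h0 hmono hright hex r t
  have hne : {q : ℝ≥0 | 0 < q ∧ (t : ℝ) ≤ η q ω}.Nonempty := hex t
  rw [← not_iff_not, not_lt, not_lt]
  constructor
  · intro hle
    have hgt : ∀ q > r, (t : ℝ) ≤ η q ω := by
      intro q hq
      obtain ⟨q', hq', hlt⟩ := (csInf_lt_iff (OrderBot.bddBelow _) hne).1 (lt_of_le_of_lt hle hq)
      exact hq'.2.trans (hmono hlt.le)
    have hc : ContinuousWithinAt (fun q : ℝ≥0 ↦ η q ω) (Set.Ioi r) r :=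
      (hright r).mono Set.Ioi_subset_Ici_self
    refine ge_of_tendsto hc ?_
    filter_upwards [self_mem_nhdsWithin] with q hq using hgt q hq
  · intro hle
    refine le_of_forall_gt_imp_ge_of_dense fun q hq ↦ ?_
    exact csInf_le (OrderBot.bddBelow _) ⟨zero_le.trans_lt hq, hle.trans (hmono hq.le)⟩

lemma IsStableSubordinator.ae_monotone_inverseProcess (hη : IsStableSubordinator α η P) :
    ∀ᵐ ω ∂P, Monotone fun t ↦ inverseProcess η t ω := by
  filter_upwards [hη.ae_lt_inverseProcess_iff] with ω h s t hst
  refine le_of_forall_lt fun r hr ↦ ?_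
  rw [h] at hr ⊢
  exact hr.trans_le (by exact_mod_cast hst)

lemma IsStableSubordinator.ae_tendsto_inverseProcess (hη : IsStableSubordinator α η P) :
    ∀ᵐ ω ∂P, Tendsto (fun t ↦ inverseProcess η t ω) atTop atTop := by
  filter_upwards [hη.ae_lt_inverseProcess_iff] with ω h
  refine tendsto_atTop.2 fun r ↦ ?_
  filter_upwards [eventually_gt_atTop (η r ω).toNNReal] with t ht
  refine ((h r t).2 ?_).le
  exact (Real.le_coe_toNNReal _).trans_lt (by exact_mod_cast ht)

lemma IsStableSubordinator.aemeasurable_inverseProcess (hη : IsStableSubordinator α η P)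
    (t : ℝ≥0) : AEMeasurable (inverseProcess η t) P := by
  obtain ⟨G, hG, hGm, hGs⟩ := hη.ae_lt_inverseProcess_iff.exists_measurable_mem
  classical
  refine ⟨G.indicator (inverseProcess η t), ?_, ?_⟩
  · refine measurable_of_Ioi fun r ↦ ?_
    have : G.indicator (inverseProcess η t) ⁻¹' Set.Ioi r = G ∩ {ω | η r ω < t} := by
      ext ω
      by_cases hω : ω ∈ G
      · simp [hω, hGs ω hω r t]
      · simp [hω]
    rw [this]
    exact hGm.inter (measurableSet_lt (hη.measurable r) measurable_const)
  · filter_upwards [hG] with ω hω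
    simp [hω]

/-- Self-similarity of the stable subordinator, from uniqueness of Laplace transforms. -/
lemma IsStableSubordinator.measure_scaling (hη : IsStableSubordinator α η P) {c : ℝ≥0}
    (r : ℝ≥0) (t : ℝ≥0) (hc : 0 < c) :
    P {ω | η (c ^ α * r) ω < (c * t : ℝ≥0)} = P {ω | η r ω < t} := by
  have hmeas : ∀ r, Measurable fun ω ↦ (η r ω).toNNReal := fun r ↦ (hη.measurable r).real_toNNReal
  have hlaw : P.map (fun ω ↦ (η (c ^ α * r) ω).toNNReal) =
      P.map (fun ω ↦ c * (η r ω).toNNReal) := by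
    have := Measure.isProbabilityMeasure_map (μ := P) (hmeas (c ^ α * r)).aemeasurable
    have := Measure.isProbabilityMeasure_map (μ := P) ((hmeas r).const_mul c).aemeasurable
    refine ext_of_integral_exp_neg_nat_mul fun n ↦ ?_
    rw [integral_map (hmeas _).aemeasurable (by fun_prop),
      integral_map ((hmeas _).const_mul c).aemeasurable (by fun_prop)]
    have e1 := hη.laplace (c ^ α * r) n (Nat.cast_nonneg n)
    have e2 := hη.laplace r (n * c) (by positivity)
    rw [Real.mul_rpow (by positivity) (by positivity)] at e2
    calc _ = ∫ ω, Real.exp (-(n : ℝ) * η (c ^ α * r) ω) ∂P := by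
          refine integral_congr_ae ?_
          filter_upwards [hη.ae_nonneg] with ω hω
          simp [Real.coe_toNNReal _ (hω _)]
      _ = ∫ ω, Real.exp (-(n * c : ℝ) * η r ω) ∂P := by
          rw [e1, e2]; congr 1; push_cast; ring
      _ = _ := by
          refine integral_congr_ae ?_
          filter_upwards [hη.ae_nonneg] with ω hω
          simp [Real.coe_toNNReal _ (hω _), mul_assoc]
  have := congrArg (fun κ ↦ κ (Set.Iio (c * t))) hlaw
  simp only [Measure.map_apply (hmeas _) measurableSet_Iio,
    Measure.map_apply ((hmeas _).const_mul c) measurableSet_Iio] at this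
  calc _ = _ := ?_
    _ = _ := this
    _ = _ := ?_
  · refine measure_congr ?_
    filter_upwards [hη.ae_nonneg] with ω hω
    apply propext
    change η (c ^ α * r) ω < (c * t : ℝ≥0) ↔ (η (c ^ α * r) ω).toNNReal < c * t
    rw [← NNReal.coe_lt_coe, Real.coe_toNNReal _ (hω _)]
  · refine measure_congr ?_
    filter_upwards [hη.ae_nonneg] with ω hω
    apply propext
    change c * (η r ω).toNNReal < c * t ↔ η r ω < t
    rw [mul_lt_mul_iff_right₀ hc, ← NNReal.coe_lt_coe, Real.coe_toNNReal _ (hω _)]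

/-- Self-similarity of the inverse stable subordinator. -/
lemma IsStableSubordinator.map_inverseProcess_mul (hη : IsStableSubordinator α η P) {c : ℝ≥0}
    (t : ℝ≥0) (hc : 0 < c) :
    P.map (inverseProcess η (c * t)) = P.map (fun ω ↦ c ^ α * inverseProcess η t ω) := by
  have hT := hη.aemeasurable_inverseProcess
  have hT' : AEMeasurable (fun ω ↦ c ^ α * inverseProcess η t ω) P := (hT t).const_mul _
  have := Measure.isProbabilityMeasure_map (μ := P) (hT (c * t))
  have := Measure.isProbabilityMeasure_map (μ := P) hT'
  have hca : 0 < c ^ α := NNReal.rpow_pos hc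
  refine Measure.ext_of_Iic _ _ fun x ↦ ?_
  rw [← compl_compl (Set.Iic x), prob_compl_eq_one_sub measurableSet_Iic.compl,
    prob_compl_eq_one_sub measurableSet_Iic.compl, Set.compl_Iic,
    Measure.map_apply_of_aemeasurable (hT _) measurableSet_Ioi,
    Measure.map_apply_of_aemeasurable hT' measurableSet_Ioi]
  congr 1
  obtain ⟨y, rfl⟩ : ∃ y, x = c ^ α * y := ⟨x / c ^ α, by field_simp⟩
  calc _ = P {ω | η (c ^ α * y) ω < (c * t : ℝ≥0)} := by
        refine measure_congr ?_
        filter_upwards [hη.ae_lt_inverseProcess_iff] with ω h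
        exact propext (h _ _)
    _ = P {ω | η y ω < t} := hη.measure_scaling y t hc
    _ = _ := by
        refine measure_congr ?_
        filter_upwards [hη.ae_lt_inverseProcess_iff] with ω h
        apply propext
        change η y ω < t ↔ c ^ α * y < c ^ α * inverseProcess η t ω
        rw [mul_lt_mul_iff_right₀ hca, h]

end Inverse

/-! ### Moments of the inverse stable subordinator -/

section Moments

variable {Ω : Type*} [MeasurableSpace Ω] {P : Measure Ω} [IsProbabilityMeasure P] {α : ℝ}
  {η : ℝ≥0 → Ω → ℝ}

lemma IsStableSubordinator.measure_lt_inverseProcess (hη : IsStableSubordinator α η P)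
    (r t : ℝ≥0) : P {ω | r < inverseProcess η t ω} = P {ω | η r ω < t} := by
  refine measure_congr ?_
  filter_upwards [hη.ae_lt_inverseProcess_iff] with ω h
  exact propext (h r t)

lemma IsStableSubordinator.measure_coe_lt_inverseProcess (hη : IsStableSubordinator α η P)
    {r : ℝ} (hr : 0 ≤ r) (t : ℝ≥0) :
    P {ω | r < (inverseProcess η t ω : ℝ)} = P {ω | η r.toNNReal ω < t} := by
  rw [← hη.measure_lt_inverseProcess]
  congr 1
  ext ω
  simp only [Set.mem_ofPred_eq]
  rw [← NNReal.coe_lt_coe, Real.coe_toNNReal _ hr]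

lemma IsStableSubordinator.aemeasurable_coe_inverseProcess (hη : IsStableSubordinator α η P)
    (t : ℝ≥0) : AEMeasurable (fun ω ↦ (inverseProcess η t ω : ℝ)) P :=
  (hη.aemeasurable_inverseProcess t).coe_nnreal_real

lemma IsStableSubordinator.lintegral_rpow_lt_top (hη : IsStableSubordinator α η P)
    (t : ℝ≥0) {q : ℝ} (hq : 0 < q) :
    ∫⁻ ω, ENNReal.ofReal ((inverseProcess η t ω : ℝ) ^ q) ∂P < ⊤ := by
  rw [lintegral_rpow_eq_lintegral_meas_lt_mul P (Eventually.of_forall fun ω ↦ NNReal.coe_nonneg _)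
    (hη.aemeasurable_coe_inverseProcess t) hq]
  refine ENNReal.mul_lt_top ENNReal.ofReal_lt_top ?_
  have hint := (Real.GammaIntegral_convergent hq).const_mul (Real.exp t)
  refine lt_of_le_of_lt ?_ hint.lintegral_lt_top
  refine setLIntegral_mono' measurableSet_Ioi fun v hv ↦ ?_
  rw [hη.measure_coe_lt_inverseProcess (le_of_lt hv)]
  calc _ ≤ ENNReal.ofReal (Real.exp (t - (v.toNNReal : ℝ))) * ENNReal.ofReal (v ^ (q - 1)) := by
        gcongr
        exact hη.measure_lt_le _ _
    _ = _ := by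
        rw [← ENNReal.ofReal_mul (Real.exp_pos _).le, Real.coe_toNNReal _ (le_of_lt hv),
          sub_eq_add_neg, Real.exp_add, mul_assoc]

lemma IsStableSubordinator.integrable_rpow (hη : IsStableSubordinator α η P)
    (t : ℝ≥0) {q : ℝ} (hq : 0 < q) :
    Integrable (fun ω ↦ (inverseProcess η t ω : ℝ) ^ q) P :=
  (lintegral_ofReal_ne_top_iff_integrable
    ((hη.aemeasurable_coe_inverseProcess t).pow_const q).aestronglyMeasurable
    (Eventually.of_forall fun ω ↦ by positivity)).1 (hη.lintegral_rpow_lt_top t hq).ne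

lemma IsStableSubordinator.integral_rpow_mul (hη : IsStableSubordinator α η P) {c : ℝ≥0}
    (t : ℝ≥0) (hc : 0 < c) (q : ℝ) :
    ∫ ω, (inverseProcess η (c * t) ω : ℝ) ^ q ∂P =
      (c : ℝ) ^ (α * q) * ∫ ω, (inverseProcess η t ω : ℝ) ^ q ∂P := by
  have hT := hη.aemeasurable_inverseProcess
  have hsm : ∀ μ : Measure ℝ≥0, AEStronglyMeasurable (fun x : ℝ≥0 ↦ (x : ℝ) ^ q) μ :=
    fun μ ↦ (measurable_subtype_coe.pow_const q).aestronglyMeasurable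
  calc _ = ∫ x : ℝ≥0, (x : ℝ) ^ q ∂(P.map (inverseProcess η (c * t))) := by
        rw [integral_map (hT _) (hsm _)]
    _ = ∫ x : ℝ≥0, (x : ℝ) ^ q ∂(P.map (fun ω ↦ c ^ α * inverseProcess η t ω)) := by
        rw [hη.map_inverseProcess_mul t hc]
    _ = ∫ ω, (c : ℝ) ^ (α * q) * (inverseProcess η t ω : ℝ) ^ q ∂P := by
        rw [integral_map ((hT _).const_mul _) (hsm _)]
        refine integral_congr_ae (Eventually.of_forall fun ω ↦ ?_)
        simp only
        push_cast
        rw [Real.mul_rpow (by positivity) (by positivity), Real.rpow_mul (by positivity)]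
    _ = _ := integral_const_mul _ _

/-- The `q`-th moment of `T_t` is `t ^ (α q)` times that of `T_1`. -/
lemma IsStableSubordinator.integral_rpow_eq (hη : IsStableSubordinator α η P)
    {t : ℝ≥0} (ht : 0 < t) (q : ℝ) :
    ∫ ω, (inverseProcess η t ω : ℝ) ^ q ∂P =
      (t : ℝ) ^ (α * q) * ∫ ω, (inverseProcess η 1 ω : ℝ) ^ q ∂P := by
  simpa using hη.integral_rpow_mul 1 ht q

/-- As `α < 1`, the subordinator stays below any level with positive probability: otherwise
`exp (-r u ^ α) ≤ exp (-u t)` for all `u`. -/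
lemma IsStableSubordinator.measure_lt_pos (hη : IsStableSubordinator α η P) (hα1 : α < 1)
    (r : ℝ≥0) {t : ℝ≥0} (ht : 0 < t) : 0 < P {ω | η r ω < t} := by
  rw [pos_iff_ne_zero]
  intro h0
  have hge : ∀ᵐ ω ∂P, (t : ℝ) ≤ η r ω := by
    rw [ae_iff]; simpa using h0
  have hu : ∀ u : ℝ, 0 < u → u * t ≤ r * u ^ α := by
    intro u hu
    have h1 := hη.laplace r u hu.le
    have h2 : ∫ ω, Real.exp (-u * η r ω) ∂P ≤ ∫ _, Real.exp (-u * t) ∂P := by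
      refine integral_mono_of_nonneg (Eventually.of_forall fun ω ↦ (Real.exp_pos _).le)
        (integrable_const _) ?_
      filter_upwards [hge] with ω hω
      refine Real.exp_le_exp.2 ?_
      nlinarith
    rw [h1, integral_const, probReal_univ, one_smul, Real.exp_le_exp] at h2
    linarith
  have hlim : Tendsto (fun u : ℝ ↦ t * u ^ (1 - α)) atTop atTop :=
    (tendsto_rpow_atTop (by linarith)).const_mul_atTop (by exact_mod_cast ht)
  obtain ⟨u, hu1, hu2⟩ := ((hlim.eventually_gt_atTop (r : ℝ)).and (eventually_gt_atTop 0)).exists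
  have h3 := hu u hu2
  have h4 : u = u ^ (1 - α) * u ^ α := by
    rw [← Real.rpow_add hu2]; simp
  have h5 : 0 < u ^ α := Real.rpow_pos_of_pos hu2 _
  have : r * u ^ α < u * t := by
    calc r * u ^ α < (t * u ^ (1 - α)) * u ^ α := by gcongr
      _ = (u ^ (1 - α) * u ^ α) * t := by ring
      _ = u * t := by rw [← h4]
  linarith

lemma IsStableSubordinator.integral_rpow_pos (hη : IsStableSubordinator α η P) (hα1 : α < 1)
    {t : ℝ≥0} (ht : 0 < t) {q : ℝ} (hq : 0 < q) :
    0 < ∫ ω, (inverseProcess η t ω : ℝ) ^ q ∂P := by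
  rw [integral_pos_iff_support_of_nonneg (fun ω ↦ by positivity) (hη.integrable_rpow t hq)]
  refine (hη.measure_lt_pos hα1 1 ht).trans_le ?_
  rw [← hη.measure_lt_inverseProcess]
  refine measure_mono fun ω hω ↦ ?_
  have : (0 : ℝ) < inverseProcess η t ω := by
    have : (1 : ℝ≥0) < inverseProcess η t ω := hω
    exact_mod_cast zero_lt_one.trans this
  exact (Real.rpow_pos_of_pos this q).ne'

end Moments

/-! ### A two-variable layer cake formula -/

section LayerCake

variable {Ω : Type*} [MeasurableSpace Ω] {P : Measure Ω} [IsProbabilityMeasure P]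

lemma ofReal_rpow_sub_rpow_eq {p s t : ℝ} (hp : 1 < p) (hs : 0 ≤ s) (hst : s ≤ t) :
    ENNReal.ofReal (t ^ p - (t - s) ^ p) =
      ENNReal.ofReal p * ∫⁻ r in Set.Ioi 0,
        (Set.Iio s).indicator (fun r ↦ ENNReal.ofReal ((t - r) ^ (p - 1))) r := by
  rw [lintegral_indicator measurableSet_Iio, Measure.restrict_restrict measurableSet_Iio]
  have hset : Set.Iio s ∩ Set.Ioi 0 = Set.Ioo 0 s := by
    ext r; simp [and_comm]
  have hcont : Continuous fun r : ℝ ↦ (t - r) ^ (p - 1) :=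
    (continuous_const.sub continuous_id).rpow_const fun _ ↦ Or.inr (by linarith)
  have hint : ∫ r in (0 : ℝ)..s, (t - r) ^ (p - 1) = (t ^ p - (t - s) ^ p) / p := by
    rw [intervalIntegral.integral_comp_sub_left (fun x ↦ x ^ (p - 1)), sub_zero,
      integral_rpow (Or.inl (by linarith)), sub_add_cancel]
  rw [hset, ← ofReal_integral_eq_lintegral_ofReal, ← integral_Ioc_eq_integral_Ioo,
    ← intervalIntegral.integral_of_le hs, hint, ← ENNReal.ofReal_mul (by linarith),
    mul_div_cancel₀ _ (by linarith)]
  · exact (hcont.integrableOn_Icc (a := 0) (b := s)).mono_set Set.Ioo_subset_Icc_self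
  · refine (ae_restrict_iff' measurableSet_Ioo).2 (Eventually.of_forall fun r hr ↦ ?_)
    exact Real.rpow_nonneg (by linarith [hr.2]) _

/-- For random variables `0 ≤ S ≤ T`, the mean of `T ^ p - (T - S) ^ p` in terms of the
joint tail `P (r < S, r + v < T)`. -/
lemma lintegral_rpow_sub_rpow_eq {S T : Ω → ℝ} (hS : AEMeasurable S P) (hT : AEMeasurable T P)
    (hS0 : ∀ᵐ ω ∂P, 0 ≤ S ω) (hST : ∀ᵐ ω ∂P, S ω ≤ T ω) {p : ℝ} (hp : 1 < p) :
    ∫⁻ ω, ENNReal.ofReal (T ω ^ p - (T ω - S ω) ^ p) ∂P =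
      ENNReal.ofReal p * (ENNReal.ofReal (p - 1) * ∫⁻ r in Set.Ioi 0, ∫⁻ v in Set.Ioi 0,
        P {ω | r < S ω ∧ v < T ω - r} * ENNReal.ofReal (v ^ (p - 1 - 1))) := by
  wlog hmeas : Measurable S ∧ Measurable T generalizing S T
  · have hS' := hS.ae_eq_mk
    have hT' := hT.ae_eq_mk
    have := this (S := hS.mk S) (T := hT.mk T) hS.measurable_mk.aemeasurable
      hT.measurable_mk.aemeasurable
      (by filter_upwards [hS0, hS'] with ω h0 h1; rwa [← h1])
      (by filter_upwards [hST, hS', hT'] with ω h0 h1 h2; rwa [← h1, ← h2])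
      ⟨hS.measurable_mk, hT.measurable_mk⟩
    calc _ = _ := ?_
      _ = _ := this
      _ = _ := ?_
    · refine lintegral_congr_ae ?_
      filter_upwards [hS', hT'] with ω h1 h2
      rw [h1, h2]
    · have hm : ∀ r v : ℝ, P {ω | r < hS.mk S ω ∧ v < hT.mk T ω - r} =
          P {ω | r < S ω ∧ v < T ω - r} := by
        intro r v
        refine measure_congr ?_
        filter_upwards [hS', hT'] with ω h1 h2
        apply propext
        change r < hS.mk S ω ∧ v < hT.mk T ω - r ↔ r < S ω ∧ v < T ω - r
        rw [h1, h2]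
      simp_rw [hm]
  obtain ⟨hSm, hTm⟩ := hmeas
  -- For fixed `r`, this is the layer cake formula for `T - r` under `P` restricted to `r < S`.
  have hinner : ∀ r : ℝ, ENNReal.ofReal (p - 1) * ∫⁻ v in Set.Ioi 0,
      P {ω | r < S ω ∧ v < T ω - r} * ENNReal.ofReal (v ^ (p - 1 - 1)) =
      ∫⁻ ω, {ω | r < S ω}.indicator (fun ω ↦ ENNReal.ofReal ((T ω - r) ^ (p - 1))) ω ∂P := by
    intro r
    have hset : MeasurableSet {ω | r < S ω} := measurableSet_lt measurable_const hSm
    rw [lintegral_indicator hset, lintegral_rpow_eq_lintegral_meas_lt_mul _ _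
      (hTm.sub_const r).aemeasurable (by linarith)]
    · congr 1
      refine lintegral_congr fun v ↦ ?_
      rw [Measure.restrict_apply' hset]
      congr 2
      ext ω; simp [and_comm]
    · refine (ae_restrict_iff' hset).2 ?_
      filter_upwards [hST] with ω h hr
      have : r < S ω := hr
      simp only [Pi.zero_apply]
      linarith
  rw [← lintegral_const_mul' _ _ ENNReal.ofReal_ne_top]
  simp_rw [hinner]
  rw [lintegral_lintegral_swap]
  · rw [← lintegral_const_mul' _ _ ENNReal.ofReal_ne_top]
    refine lintegral_congr_ae ?_
    filter_upwards [hS0, hST] with ω h0 h1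
    rw [ofReal_rpow_sub_rpow_eq hp h0 h1]
    rfl
  · have hset : MeasurableSet {x : ℝ × Ω | x.1 < S x.2} :=
      measurableSet_lt measurable_fst (hSm.comp measurable_snd)
    have : Measurable fun x : ℝ × Ω ↦ ENNReal.ofReal ((T x.2 - x.1) ^ (p - 1)) := by fun_prop
    exact (this.indicator hset).aemeasurable

/-- The right-hand side of `lintegral_rpow_sub_rpow_eq` with the joint tail replaced by a product
of tails. -/
lemma lintegral_tail_mul_tail_eq {S T : Ω → ℝ} (hS : AEMeasurable S P) (hT : AEMeasurable T P)
    (hS0 : ∀ ω, 0 ≤ S ω) (hT0 : ∀ ω, 0 ≤ T ω) {p : ℝ} (hp : 1 < p) :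
    ENNReal.ofReal p * (ENNReal.ofReal (p - 1) * ∫⁻ r in Set.Ioi 0, ∫⁻ v in Set.Ioi 0,
        P {ω | r < S ω} * P {ω | v < T ω} * ENNReal.ofReal (v ^ (p - 1 - 1))) =
      ENNReal.ofReal p * ((∫⁻ ω, ENNReal.ofReal (S ω) ∂P) *
        ∫⁻ ω, ENNReal.ofReal (T ω ^ (p - 1)) ∂P) := by
  rw [lintegral_rpow_eq_lintegral_meas_lt_mul P (Eventually.of_forall hT0) hT (by linarith),
    lintegral_eq_lintegral_meas_lt P (Eventually.of_forall hS0) hS]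
  simp_rw [mul_assoc]
  have h1 : ∀ r : ℝ, ∫⁻ v in Set.Ioi (0 : ℝ), P {ω | r < S ω} *
      (P {ω | v < T ω} * ENNReal.ofReal (v ^ (p - 1 - 1))) = P {ω | r < S ω} *
      ∫⁻ v in Set.Ioi (0 : ℝ), P {ω | v < T ω} * ENNReal.ofReal (v ^ (p - 1 - 1)) :=
    fun r ↦ lintegral_const_mul' _ _ (measure_ne_top _ _)
  simp_rw [h1]
  have hanti : Antitone fun r : ℝ ↦ P {ω | r < S ω} :=
    fun a b hab ↦ measure_mono fun ω hω ↦ lt_of_le_of_lt hab hω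
  rw [lintegral_mul_const _ hanti.measurable]
  ring

end LayerCake

/-! ### The increment of the `p`-th moment over an initial segment -/

section Increment

variable {Ω : Type*} [MeasurableSpace Ω] {P : Measure Ω} {α : ℝ}
  {η : ℝ≥0 → Ω → ℝ}

/-- `η_r` and `η_{r + v} - η_r` are independent, and the latter has the law of `η_v`. -/
lemma IsStableSubordinator.measure_increment_lt (hη : IsStableSubordinator α η P) (r v : ℝ≥0)
    (s t : ℝ) : P {ω | η r ω < s ∧ η (r + v) ω - η r ω < t} =
      P {ω | η r ω < s} * P {ω | η v ω < t} := by
  have h := hη.indepIncrements.indepFun_eval_sub (zero_le (a := r)) (le_self_add (b := v))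
    hη.start_zero
  have h2 := h.measure_inter_preimage_eq_mul _ _ (measurableSet_Iio (a := s))
    (measurableSet_Iio (a := t))
  have h3 := (hη.stationaryIncrements r v).measure_preimage_eq (measurableSet_Iio (a := t))
  rw [h3] at h2
  exact h2

variable [IsProbabilityMeasure P]

lemma IsStableSubordinator.measure_tail_eq (hη : IsStableSubordinator α η P) {r v : ℝ}
    (hr : 0 ≤ r) (hv : 0 ≤ v) (s t : ℝ≥0) :
    P {ω | r < (inverseProcess η s ω : ℝ) ∧ v < (inverseProcess η t ω : ℝ) - r} =
      P {ω | η r.toNNReal ω < s ∧ η (r.toNNReal + v.toNNReal) ω < t} := by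
  refine measure_congr ?_
  filter_upwards [hη.ae_lt_inverseProcess_iff] with ω h
  apply propext
  change (r < (inverseProcess η s ω : ℝ) ∧ v < (inverseProcess η t ω : ℝ) - r) ↔
    (η r.toNNReal ω < s ∧ η (r.toNNReal + v.toNNReal) ω < t)
  rw [← h, ← h, ← NNReal.coe_lt_coe, ← NNReal.coe_lt_coe, NNReal.coe_add,
    Real.coe_toNNReal _ hr, Real.coe_toNNReal _ hv, lt_sub_iff_add_lt']

/-- As `η_r ≥ 0`, the event `η_{r + v} < t` forces `η_{r + v} - η_r < t`. -/
lemma IsStableSubordinator.measure_tail_le (hη : IsStableSubordinator α η P) {r v : ℝ}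
    (hr : 0 ≤ r) (hv : 0 ≤ v) (s t : ℝ≥0) :
    P {ω | r < (inverseProcess η s ω : ℝ) ∧ v < (inverseProcess η t ω : ℝ) - r} ≤
      P {ω | r < (inverseProcess η s ω : ℝ)} * P {ω | v < (inverseProcess η t ω : ℝ)} := by
  rw [hη.measure_tail_eq hr hv, hη.measure_coe_lt_inverseProcess hr,
    hη.measure_coe_lt_inverseProcess hv, ← hη.measure_increment_lt]
  refine measure_mono_ae ?_
  filter_upwards [hη.ae_nonneg] with ω hω h
  have h' : η r.toNNReal ω < s ∧ η (r.toNNReal + v.toNNReal) ω < t := h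
  exact ⟨h'.1, by linarith [hω r.toNNReal, h'.2]⟩

/-- If `η_r < s` and `η_{r + v} - η_r < t`, then `η_{r + v} < s + t`. -/
lemma IsStableSubordinator.le_measure_tail (hη : IsStableSubordinator α η P) {r v : ℝ}
    (hr : 0 ≤ r) (hv : 0 ≤ v) (s t : ℝ≥0) :
    P {ω | r < (inverseProcess η s ω : ℝ)} * P {ω | v < (inverseProcess η t ω : ℝ)} ≤
      P {ω | r < (inverseProcess η s ω : ℝ) ∧ v < (inverseProcess η (s + t) ω : ℝ) - r} := by
  rw [hη.measure_tail_eq hr hv, hη.measure_coe_lt_inverseProcess hr,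
    hη.measure_coe_lt_inverseProcess hv, ← hη.measure_increment_lt]
  refine measure_mono fun ω h ↦ ?_
  have h' : η r.toNNReal ω < s ∧ η (r.toNNReal + v.toNNReal) ω - η r.toNNReal ω < t := h
  refine ⟨h'.1, ?_⟩
  push_cast
  linarith [h'.1, h'.2]

lemma IsStableSubordinator.ae_inverseProcess_le (hη : IsStableSubordinator α η P) {s t : ℝ≥0}
    (hst : s ≤ t) : ∀ᵐ ω ∂P, (inverseProcess η s ω : ℝ) ≤ inverseProcess η t ω := by
  filter_upwards [hη.ae_monotone_inverseProcess] with ω h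
  exact_mod_cast h hst

lemma IsStableSubordinator.integrable_rpow_sub_rpow (hη : IsStableSubordinator α η P)
    {s t : ℝ≥0} (hst : s ≤ t) {p : ℝ} (hp : 0 < p) :
    Integrable (fun ω ↦ ((inverseProcess η t ω : ℝ) - inverseProcess η s ω) ^ p) P := by
  refine (hη.integrable_rpow t hp).mono'
    (((hη.aemeasurable_coe_inverseProcess t).sub
      (hη.aemeasurable_coe_inverseProcess s)).pow_const p).aestronglyMeasurable ?_
  filter_upwards [hη.ae_inverseProcess_le hst] with ω h
  rw [Real.norm_of_nonneg (Real.rpow_nonneg (by linarith) _)]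
  exact Real.rpow_le_rpow (by linarith) (by simp) hp.le

lemma IsStableSubordinator.ofReal_integral_rpow_sub_rpow (hη : IsStableSubordinator α η P)
    {s t : ℝ≥0} (hst : s ≤ t) {p : ℝ} (hp : 1 < p) :
    ENNReal.ofReal (∫ ω, ((inverseProcess η t ω : ℝ) ^ p -
        ((inverseProcess η t ω : ℝ) - inverseProcess η s ω) ^ p) ∂P) =
      ENNReal.ofReal p * (ENNReal.ofReal (p - 1) * ∫⁻ r in Set.Ioi 0, ∫⁻ v in Set.Ioi 0,
        P {ω | r < (inverseProcess η s ω : ℝ) ∧ v < (inverseProcess η t ω : ℝ) - r} *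
          ENNReal.ofReal (v ^ (p - 1 - 1))) := by
  rw [ofReal_integral_eq_lintegral_ofReal, lintegral_rpow_sub_rpow_eq
    (hη.aemeasurable_coe_inverseProcess s) (hη.aemeasurable_coe_inverseProcess t)
    (Eventually.of_forall fun ω ↦ NNReal.coe_nonneg _) (hη.ae_inverseProcess_le hst) hp]
  · exact (hη.integrable_rpow t (by linarith)).sub (hη.integrable_rpow_sub_rpow hst (by linarith))
  · filter_upwards [hη.ae_inverseProcess_le hst] with ω h
    simp only [Pi.zero_apply, sub_nonneg]
    exact Real.rpow_le_rpow (by linarith) (by simp) (by linarith)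

lemma IsStableSubordinator.ofReal_mul_moments_eq (hη : IsStableSubordinator α η P)
    (s t : ℝ≥0) {p : ℝ} (hp : 1 < p) :
    ENNReal.ofReal (p * ((∫ ω, (inverseProcess η s ω : ℝ) ∂P) *
        ∫ ω, (inverseProcess η t ω : ℝ) ^ (p - 1) ∂P)) =
      ENNReal.ofReal p * (ENNReal.ofReal (p - 1) * ∫⁻ r in Set.Ioi 0, ∫⁻ v in Set.Ioi 0,
        P {ω | r < (inverseProcess η s ω : ℝ)} * P {ω | v < (inverseProcess η t ω : ℝ)} *
          ENNReal.ofReal (v ^ (p - 1 - 1))) := by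
  rw [lintegral_tail_mul_tail_eq (hη.aemeasurable_coe_inverseProcess s)
    (hη.aemeasurable_coe_inverseProcess t) (fun ω ↦ NNReal.coe_nonneg _)
    (fun ω ↦ NNReal.coe_nonneg _) hp, ENNReal.ofReal_mul (by linarith),
    ENNReal.ofReal_mul (integral_nonneg fun ω ↦ NNReal.coe_nonneg _),
    ofReal_integral_eq_lintegral_ofReal, ofReal_integral_eq_lintegral_ofReal]
  · exact hη.integrable_rpow t (by linarith)
  · exact Eventually.of_forall fun ω ↦ by positivity
  · simpa using hη.integrable_rpow s zero_lt_one
  · exact Eventually.of_forall fun ω ↦ NNReal.coe_nonneg _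

lemma IsStableSubordinator.integral_rpow_sub_rpow_le (hη : IsStableSubordinator α η P)
    {s t : ℝ≥0} (hst : s ≤ t) {p : ℝ} (hp : 1 < p) :
    ∫ ω, ((inverseProcess η t ω : ℝ) ^ p -
        ((inverseProcess η t ω : ℝ) - inverseProcess η s ω) ^ p) ∂P ≤
      p * ((∫ ω, (inverseProcess η s ω : ℝ) ∂P) *
        ∫ ω, (inverseProcess η t ω : ℝ) ^ (p - 1) ∂P) := by
  rw [← ENNReal.ofReal_le_ofReal_iff, hη.ofReal_integral_rpow_sub_rpow hst hp,
    hη.ofReal_mul_moments_eq s t hp]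
  · gcongr ENNReal.ofReal p * (ENNReal.ofReal (p - 1) * ?_)
    refine setLIntegral_mono' measurableSet_Ioi fun r hr ↦
      setLIntegral_mono' measurableSet_Ioi fun v hv ↦ ?_
    gcongr
    exact hη.measure_tail_le (le_of_lt hr) (le_of_lt hv) s t
  · exact mul_nonneg (by linarith) (mul_nonneg (integral_nonneg fun ω ↦ NNReal.coe_nonneg _)
      (integral_nonneg fun ω ↦ by positivity))

lemma IsStableSubordinator.le_integral_rpow_sub_rpow (hη : IsStableSubordinator α η P)
    (s t : ℝ≥0) {p : ℝ} (hp : 1 < p) :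
    p * ((∫ ω, (inverseProcess η s ω : ℝ) ∂P) *
        ∫ ω, (inverseProcess η t ω : ℝ) ^ (p - 1) ∂P) ≤
      ∫ ω, ((inverseProcess η (s + t) ω : ℝ) ^ p -
        ((inverseProcess η (s + t) ω : ℝ) - inverseProcess η s ω) ^ p) ∂P := by
  rw [← ENNReal.ofReal_le_ofReal_iff, hη.ofReal_integral_rpow_sub_rpow le_self_add hp,
    hη.ofReal_mul_moments_eq s t hp]
  · gcongr ENNReal.ofReal p * (ENNReal.ofReal (p - 1) * ?_)
    refine setLIntegral_mono' measurableSet_Ioi fun r hr ↦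
      setLIntegral_mono' measurableSet_Ioi fun v hv ↦ ?_
    gcongr
    exact hη.le_measure_tail (le_of_lt hr) (le_of_lt hv) s t
  · refine integral_nonneg_of_ae ?_
    filter_upwards [hη.ae_inverseProcess_le (le_self_add (a := s) (b := t))] with ω h
    simp only [Pi.zero_apply, sub_nonneg]
    exact Real.rpow_le_rpow (by linarith) (by simp) (by linarith)

end Increment

/-! ### Evaluation of a continuous process at an independent random time -/

section RandomTime

variable {Ω : Type*} [MeasurableSpace Ω] {P : Measure Ω}

/-- The space of continuous paths, with the σ-algebra generated by the evaluations. Unlike on the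
space of all paths, evaluation is jointly measurable here. -/
abbrev ContinuousPath : Type := {f : ℝ≥0 → ℝ // Continuous f}

lemma measurable_eval_continuousPath :
    Measurable fun x : ContinuousPath × ℝ≥0 ↦ x.1.1 x.2 := by
  have h : Measurable (Function.uncurry fun (t : ℝ≥0) (f : ContinuousPath) ↦ f.1 t) :=
    measurable_uncurry_of_continuous_of_measurable (fun f ↦ f.2)
      fun t ↦ (measurable_pi_apply t).comp measurable_subtype_coe
  exact h.comp measurable_swap

/-- A process with almost surely continuous paths agrees almost surely with a random element of
the space of continuous paths. -/
lemma exists_continuousPath_version {B : ℝ≥0 → Ω → ℝ} (hB : ∀ t, AEMeasurable (B t) P)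
    (hc : ∀ᵐ ω ∂P, Continuous fun t ↦ B t ω) :
    ∃ Y : Ω → ContinuousPath, Measurable Y ∧ ∀ᵐ ω ∂P, ∀ t, (Y ω).1 t = B t ω := by
  let d := TopologicalSpace.denseSeq ℝ≥0
  have hae : ∀ᵐ ω ∂P, (Continuous fun t ↦ B t ω) ∧
      ∀ n, B (d n) ω = (hB (d n)).mk _ ω := by
    filter_upwards [hc, ae_all_iff.2 fun n ↦ (hB (d n)).ae_eq_mk] with ω h1 h2 using ⟨h1, h2⟩
  obtain ⟨G, hG, hGm, hGs⟩ := hae.exists_measurable_mem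
  classical
  let Y : Ω → ContinuousPath := fun ω ↦
    if h : ω ∈ G then ⟨fun t ↦ B t ω, (hGs ω h).1⟩ else ⟨fun _ ↦ 0, continuous_const⟩
  have hYd : ∀ n, Measurable fun ω ↦ (Y ω).1 (d n) := by
    intro n
    have : (fun ω ↦ (Y ω).1 (d n)) = G.indicator ((hB (d n)).mk _) := by
      ext ω
      by_cases h : ω ∈ G
      · simp [Y, h, (hGs ω h).2 n]
      · simp [Y, h]
    rw [this]
    exact (hB (d n)).measurable_mk.indicator hGm
  refine ⟨Y, ?_, ?_⟩
  -- The values at all times are limits of the values at the countably many times `d n`.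
  · refine measurable_comap_iff.2 (measurable_pi_lambda _ fun t ↦ ?_)
    obtain ⟨u, hu, hut⟩ := mem_closure_iff_seq_limit.1
      (TopologicalSpace.denseRange_denseSeq ℝ≥0 t)
    refine measurable_of_tendsto_metrizable (f := fun n ω ↦ (Y ω).1 (u n)) (fun n ↦ ?_) ?_
    · obtain ⟨k, hk⟩ := hu n
      rw [← hk]
      exact hYd k
    · exact tendsto_pi_nhds.2 fun ω ↦ ((Y ω).2.tendsto t).comp hut
  · filter_upwards [hG] with ω hω t
    simp [Y, hω]

lemma indepFun_continuousPath {B : ℝ≥0 → Ω → ℝ} {E : Type*} [MeasurableSpace E] {Z : Ω → E}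
    (h : IndepFun (fun ω t ↦ B t ω) Z P) {Y : Ω → ContinuousPath}
    (hY : ∀ᵐ ω ∂P, ∀ t, (Y ω).1 t = B t ω) : IndepFun Y Z P := by
  have h1 : IndepFun (fun ω ↦ (Y ω).1) Z P := by
    refine h.congr ?_ .rfl
    filter_upwards [hY] with ω hω
    exact funext fun t ↦ (hω t).symm
  rw [IndepFun_iff_Indep] at h1 ⊢
  have : MeasurableSpace.comap Y inferInstance =
      MeasurableSpace.comap (fun ω ↦ (Y ω).1) inferInstance := MeasurableSpace.comap_comp
  rwa [this]

variable [IsProbabilityMeasure P] {C E : Type*} [MeasurableSpace C] [MeasurableSpace E]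
  {Y : Ω → C} {Z : Ω → E}

/-- Fubini for independent `Y`, `Z`: integrability of `F (Y, Z)` by freezing the value of `Z`. -/
lemma integrable_comp_of_indepFun (h : IndepFun Y Z P) (hY : Measurable Y)
    (hZ : AEMeasurable Z P) {F : C × E → ℝ} (hF : Measurable F)
    (h1 : ∀ z, Integrable (fun ω ↦ F (Y ω, z)) P)
    (h2 : Integrable (fun ω ↦ ∫ ω', ‖F (Y ω', Z ω)‖ ∂P) P) :
    Integrable (fun ω ↦ F (Y ω, Z ω)) P := by
  have := Measure.isProbabilityMeasure_map (μ := P) hY.aemeasurable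
  have := Measure.isProbabilityMeasure_map (μ := P) hZ
  have hYZ : AEMeasurable (fun ω ↦ (Y ω, Z ω)) P := hY.aemeasurable.prodMk hZ
  have key : Integrable F (P.map fun ω ↦ (Y ω, Z ω)) := by
    rw [h.map_prod_eq_prod_map_map hY.aemeasurable hZ,
      integrable_prod_iff' hF.aestronglyMeasurable]
    have hsec : ∀ z, Measurable fun y ↦ F (y, z) := fun z ↦ hF.comp measurable_prodMk_right
    refine ⟨Eventually.of_forall fun z ↦ ?_, ?_⟩
    · rw [integrable_map_measure (hsec z).aestronglyMeasurable hY.aemeasurable]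
      exact h1 z
    · rw [integrable_map_measure _ hZ]
      · convert h2 using 2 with ω
        exact integral_map hY.aemeasurable (hsec _).norm.aestronglyMeasurable
      · exact (hF.norm.stronglyMeasurable.integral_prod_left').aestronglyMeasurable
  exact (integrable_map_measure hF.aestronglyMeasurable hYZ).1 key

/-- Fubini for independent `Y`, `Z`: the mean of `F (Y, Z)` by freezing the value of `Z`. -/
lemma integral_comp_of_indepFun (h : IndepFun Y Z P) (hY : Measurable Y)
    (hZ : AEMeasurable Z P) {F : C × E → ℝ} (hF : Measurable F)
    (hint : Integrable (fun ω ↦ F (Y ω, Z ω)) P) :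
    ∫ ω, F (Y ω, Z ω) ∂P = ∫ ω, ∫ ω', F (Y ω', Z ω) ∂P ∂P := by
  have := Measure.isProbabilityMeasure_map (μ := P) hY.aemeasurable
  have := Measure.isProbabilityMeasure_map (μ := P) hZ
  have hYZ : AEMeasurable (fun ω ↦ (Y ω, Z ω)) P := hY.aemeasurable.prodMk hZ
  have hF' : Integrable F (P.map fun ω ↦ (Y ω, Z ω)) :=
    (integrable_map_measure hF.aestronglyMeasurable hYZ).2 hint
  have hsec : ∀ z, Measurable fun y ↦ F (y, z) := fun z ↦ hF.comp measurable_prodMk_right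
  rw [← integral_map (f := F) hYZ hF.aestronglyMeasurable]
  rw [h.map_prod_eq_prod_map_map hY.aemeasurable hZ] at hF' ⊢
  rw [integral_prod_symm _ hF', integral_map hZ]
  · refine integral_congr_ae (Eventually.of_forall fun ω ↦ ?_)
    exact integral_map hY.aemeasurable (hsec _).aestronglyMeasurable
  · exact hF.stronglyMeasurable.integral_prod_left'.aestronglyMeasurable

end RandomTime

/-! ### Second moments of time-changed fractional Brownian motion -/

section SecondMoments

variable {Ω : Type*} [MeasurableSpace Ω] {P : Measure Ω} {H : ℝ}
  {B : ℝ≥0 → Ω → ℝ}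

/-- The covariance function of fractional Brownian motion with Hurst index `H`. -/
noncomputable def fbmCov (H : ℝ) (s t : ℝ≥0) : ℝ :=
  ((t : ℝ) ^ (2 * H) + (s : ℝ) ^ (2 * H) - |(t : ℝ) - (s : ℝ)| ^ (2 * H)) / 2

lemma fbmCov_self {H : ℝ} (hH : 0 < H) (t : ℝ≥0) : fbmCov H t t = (t : ℝ) ^ (2 * H) := by
  rw [fbmCov, sub_self, abs_zero, Real.zero_rpow (by positivity)]
  ring

lemma IsFractionalBrownianMotion.memLp_two (hB : IsFractionalBrownianMotion H B P) (t : ℝ≥0) :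
    MemLp (B t) 2 P :=
  (hB.isGaussianProcess.hasGaussianLaw_eval t).memLp_two

variable [IsProbabilityMeasure P]

lemma IsFractionalBrownianMotion.integral_mul (hB : IsFractionalBrownianMotion H B P)
    (s t : ℝ≥0) : ∫ ω, B s ω * B t ω ∂P = fbmCov H s t := by
  have := hB.covariance_eq s t
  rw [covariance_eq_sub (hB.memLp_two s) (hB.memLp_two t), hB.centered, hB.centered] at this
  simpa [fbmCov] using this

lemma IsFractionalBrownianMotion.integral_sq (hB : IsFractionalBrownianMotion H B P)
    (hH : 0 < H) (t : ℝ≥0) : ∫ ω, B t ω ^ 2 ∂P = (t : ℝ) ^ (2 * H) := by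
  simp_rw [pow_two, hB.integral_mul t t, fbmCov_self hH]

/-- The first two moments of a fractional Brownian motion at independent random times: condition
on the times. -/
lemma IsFractionalBrownianMotion.timeChange_moments (hB : IsFractionalBrownianMotion H B P)
    (hH : 0 < H) {T : ℝ≥0 → Ω → ℝ≥0} (hT : ∀ t, AEMeasurable (T t) P)
    (hTi : ∀ t, Integrable (fun ω ↦ (T t ω : ℝ) ^ (2 * H)) P)
    (hindep : IndepFun (fun ω t ↦ B t ω) (fun ω t ↦ T t ω) P) (s t : ℝ≥0) :
    MemLp (timeChange B T t) 2 P ∧ ∫ ω, timeChange B T t ω ∂P = 0 ∧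
      ∫ ω, timeChange B T s ω * timeChange B T t ω ∂P = ∫ ω, fbmCov H (T s ω) (T t ω) ∂P := by
  obtain ⟨Y, hYm, hY⟩ := exists_continuousPath_version
    (fun t ↦ hB.isGaussianProcess.aemeasurable t) hB.continuous_paths
  have hYB : ∀ r, (fun ω ↦ (Y ω).1 r) =ᵐ[P] B r := fun r ↦ by
    filter_upwards [hY] with ω h using h r
  have hX : ∀ t, (fun ω ↦ (Y ω).1 (T t ω)) =ᵐ[P] timeChange B T t := fun t ↦ by
    filter_upwards [hY] with ω h using h _
  have hev := measurable_eval_continuousPath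
  have hYT := indepFun_continuousPath hindep hY
  have hmem : ∀ t, MemLp (fun ω ↦ (Y ω).1 (T t ω)) 2 P := by
    intro t
    have hi : IndepFun Y (T t) P := hYT.comp measurable_id (measurable_pi_apply t)
    have hsm : AEStronglyMeasurable (fun ω ↦ (Y ω).1 (T t ω)) P :=
      (hev.comp_aemeasurable (hYm.aemeasurable.prodMk (hT t))).aestronglyMeasurable
    rw [memLp_two_iff_integrable_sq hsm]
    refine integrable_comp_of_indepFun (F := fun x : ContinuousPath × ℝ≥0 ↦ x.1.1 x.2 ^ 2)
      hi hYm (hT t) (hev.pow_const 2) (fun r ↦ ?_) ?_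
    · exact ((memLp_congr_ae (hYB r)).2 (hB.memLp_two r)).integrable_sq
    · refine (hTi t).congr (Eventually.of_forall fun ω ↦ ?_)
      simp only [Real.norm_eq_abs, abs_pow, sq_abs]
      rw [← hB.integral_sq hH]
      refine integral_congr_ae ?_
      filter_upwards [hYB (T t ω)] with ω' h
      rw [h]
  refine ⟨(memLp_congr_ae (hX t)).1 (hmem t), ?_, ?_⟩
  · have hi : IndepFun Y (T t) P := hYT.comp measurable_id (measurable_pi_apply t)
    rw [← integral_congr_ae (hX t), integral_comp_of_indepFun
      (F := fun x : ContinuousPath × ℝ≥0 ↦ x.1.1 x.2) hi hYm (hT t) hev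
      ((hmem t).integrable one_le_two)]
    refine integral_eq_zero_of_ae (Eventually.of_forall fun ω ↦ ?_)
    exact (integral_congr_ae (hYB _)).trans (hB.centered _)
  · have hi : IndepFun Y (fun ω ↦ (T s ω, T t ω)) P :=
      hYT.comp measurable_id ((measurable_pi_apply s).prodMk (measurable_pi_apply t))
    have e : ∫ ω, timeChange B T s ω * timeChange B T t ω ∂P =
        ∫ ω, (Y ω).1 (T s ω) * (Y ω).1 (T t ω) ∂P := by
      refine integral_congr_ae ?_
      filter_upwards [hX s, hX t] with ω h1 h2
      rw [h1, h2]
    have hF : Measurable fun x : ContinuousPath × (ℝ≥0 × ℝ≥0) ↦ x.1.1 x.2.1 * x.1.1 x.2.2 :=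
      (hev.comp (measurable_fst.prodMk measurable_snd.fst)).mul
        (hev.comp (measurable_fst.prodMk measurable_snd.snd))
    rw [e, integral_comp_of_indepFun
      (F := fun x : ContinuousPath × (ℝ≥0 × ℝ≥0) ↦ x.1.1 x.2.1 * x.1.1 x.2.2) hi hYm
      ((hT s).prodMk (hT t)) hF ((hmem s).integrable_mul (hmem t))]
    refine integral_congr_ae (Eventually.of_forall fun ω ↦ ?_)
    simp only
    rw [← hB.integral_mul]
    refine integral_congr_ae ?_
    filter_upwards [hYB (T s ω), hYB (T t ω)] with ω' h1 h2
    rw [h1, h2]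

end SecondMoments

/-! ### Asymptotics of the covariance -/

section Asymptotics

lemma tendsto_rpow_sub_rpow {p : ℝ} (hp0 : 0 ≤ p) (hp1 : p < 1) {b : ℝ} (hb : 0 ≤ b) :
    Tendsto (fun x : ℝ ↦ x ^ p - (x - b) ^ p) atTop (𝓝 0) := by
  have hlim : Tendsto (fun x : ℝ ↦ p * b * (x - b) ^ (p - 1)) atTop (𝓝 0) := by
    have h1 : Tendsto (fun y : ℝ ↦ y ^ (-(1 - p))) atTop (𝓝 0) :=
      tendsto_rpow_neg_atTop (by linarith)
    have h2 := (h1.comp (tendsto_atTop_add_const_right atTop (-b) tendsto_id)).const_mul (p * b)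
    rw [mul_zero] at h2
    refine h2.congr fun x ↦ ?_
    simp [sub_eq_add_neg]
  refine tendsto_of_tendsto_of_tendsto_of_le_of_le' tendsto_const_nhds hlim ?_ ?_
  · filter_upwards [eventually_ge_atTop b] with x hx
    exact sub_nonneg.2 (Real.rpow_le_rpow (by linarith) (by linarith) hp0)
  · filter_upwards [eventually_gt_atTop b] with x hx
    have hy : 0 < x - b := by linarith
    -- Bernoulli's inequality for `x = (x - b) (1 + b / (x - b))`
    have h1 : (1 + b / (x - b)) ^ p ≤ 1 + p * (b / (x - b)) :=
      rpow_one_add_le_one_add_mul_self (by have := div_nonneg hb hy.le; linarith) hp0 hp1.le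
    have h2 : x ^ p = (x - b) ^ p * (1 + b / (x - b)) ^ p := by
      rw [← Real.mul_rpow hy.le (by positivity)]
      congr 1
      field_simp
      ring
    rw [Real.rpow_sub_one hy.ne', h2]
    calc (x - b) ^ p * (1 + b / (x - b)) ^ p - (x - b) ^ p
        ≤ (x - b) ^ p * (1 + p * (b / (x - b))) - (x - b) ^ p := by gcongr
      _ = _ := by ring

variable {Ω : Type*} [MeasurableSpace Ω] {P : Measure Ω} [IsProbabilityMeasure P] {α : ℝ}
  {η : ℝ≥0 → Ω → ℝ}

lemma IsStableSubordinator.tendsto_increment_of_lt_one (hη : IsStableSubordinator α η P)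
    (s : ℝ≥0) {p : ℝ} (hp0 : 0 < p) (hp1 : p < 1) :
    Tendsto (fun t ↦ ∫ ω, ((inverseProcess η t ω : ℝ) ^ p -
        ((inverseProcess η t ω : ℝ) - inverseProcess η s ω) ^ p) ∂P) atTop (𝓝 0) := by
  rw [← integral_zero Ω ℝ (μ := P)]
  refine tendsto_integral_filter_of_dominated_convergence
    (fun ω ↦ (inverseProcess η s ω : ℝ) ^ p) ?_ ?_ (hη.integrable_rpow s hp0) ?_
  · exact Eventually.of_forall fun t ↦
      (((hη.aemeasurable_coe_inverseProcess t).pow_const p).sub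
      (((hη.aemeasurable_coe_inverseProcess t).sub
        (hη.aemeasurable_coe_inverseProcess s)).pow_const p)).aestronglyMeasurable
  · filter_upwards [eventually_ge_atTop s] with t ht
    filter_upwards [hη.ae_inverseProcess_le ht] with ω h
    rw [Real.norm_of_nonneg]
    · have := Real.rpow_add_le_add_rpow (sub_nonneg.2 h)
        (NNReal.coe_nonneg (inverseProcess η s ω)) hp0.le hp1.le
      rw [sub_add_cancel] at this
      linarith
    · exact sub_nonneg.2 (Real.rpow_le_rpow (by linarith) (by simp) hp0.le)
  · filter_upwards [hη.ae_tendsto_inverseProcess] with ω h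
    exact (tendsto_rpow_sub_rpow hp0.le hp1 (NNReal.coe_nonneg _)).comp
      (NNReal.tendsto_coe_atTop.2 h)

lemma tendsto_nnreal_coe_rpow_atTop {β : ℝ} (hβ : 0 < β) :
    Tendsto (fun t : ℝ≥0 ↦ (t : ℝ) ^ β) atTop atTop :=
  (tendsto_rpow_atTop hβ).comp (NNReal.tendsto_coe_atTop.2 tendsto_id)

lemma tendsto_tsub_rpow_div_rpow (s : ℝ≥0) (β : ℝ) :
    Tendsto (fun t : ℝ≥0 ↦ ((t - s : ℝ≥0) : ℝ) ^ β / (t : ℝ) ^ β) atTop (𝓝 1) := by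
  have h1 : Tendsto (fun t : ℝ≥0 ↦ 1 - (s : ℝ) / (t : ℝ)) atTop (𝓝 1) := by
    have := (NNReal.tendsto_coe_atTop.2 (tendsto_id (α := ℝ≥0) (x := atTop))).const_div_atTop
      (s : ℝ)
    simpa using this.const_sub 1
  have h2 := h1.rpow_const (p := β) (Or.inl one_ne_zero)
  rw [Real.one_rpow] at h2
  refine h2.congr' ?_
  filter_upwards [eventually_gt_atTop s] with t ht
  have ht' : (s : ℝ) < t := by exact_mod_cast ht
  have ht0 : (0 : ℝ) < t := s.coe_nonneg.trans_lt ht'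
  rw [NNReal.coe_sub ht.le, ← Real.div_rpow (by linarith) ht0.le, sub_div, div_self ht0.ne']

/-- For `p > 1` the increment grows like `t ^ (α (p - 1))`: squeeze between the two moment
bounds. -/
lemma IsStableSubordinator.tendsto_increment_of_one_lt (hη : IsStableSubordinator α η P)
    (s : ℝ≥0) {p : ℝ} (hp : 1 < p) :
    Tendsto (fun t : ℝ≥0 ↦ (∫ ω, ((inverseProcess η t ω : ℝ) ^ p -
        ((inverseProcess η t ω : ℝ) - inverseProcess η s ω) ^ p) ∂P) / (t : ℝ) ^ (α * (p - 1)))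
      atTop (𝓝 (p * ((∫ ω, (inverseProcess η s ω : ℝ) ∂P) *
        ∫ ω, (inverseProcess η 1 ω : ℝ) ^ (p - 1) ∂P))) := by
  set K := p * ((∫ ω, (inverseProcess η s ω : ℝ) ∂P) *
        ∫ ω, (inverseProcess η 1 ω : ℝ) ^ (p - 1) ∂P) with hK
  have hlow := (tendsto_tsub_rpow_div_rpow s (α * (p - 1))).const_mul K
  rw [mul_one] at hlow
  refine tendsto_of_tendsto_of_tendsto_of_le_of_le' hlow tendsto_const_nhds ?_ ?_
  · filter_upwards [eventually_gt_atTop s] with t ht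
    have h1 := hη.le_integral_rpow_sub_rpow s (t - s) hp
    rw [hη.integral_rpow_eq (tsub_pos_of_lt ht), add_tsub_cancel_of_le ht.le] at h1
    rw [mul_div_assoc']
    gcongr
    refine le_trans (le_of_eq ?_) h1
    rw [hK]
    ring
  · filter_upwards [eventually_gt_atTop s] with t ht
    have ht0 : 0 < t := lt_of_le_of_lt zero_le ht
    have h1 := hη.integral_rpow_sub_rpow_le ht.le hp
    rw [hη.integral_rpow_eq ht0] at h1
    have : (0 : ℝ) < (t : ℝ) ^ (α * (p - 1)) := Real.rpow_pos_of_pos (by exact_mod_cast ht0) _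
    rw [div_le_iff₀ this]
    refine le_trans h1 (le_of_eq ?_)
    rw [hK]
    ring

/-- With `p = 2H`, the quotient is `2 Cov (X_t, X_s) / t ^ (α max (p - 1) 0)`. For `p < 1` its limit
is `E T_s ^ p`; for `p > 1` that term is negligible and the limit comes from the increment. -/
lemma IsStableSubordinator.exists_tendsto_covariance (hη : IsStableSubordinator α η P)
    (hα0 : 0 < α) (hα1 : α < 1) {s : ℝ≥0} (hs : 0 < s) {p : ℝ} (hp : 0 < p) :
    ∃ k : ℝ, 0 < k ∧ Tendsto (fun t : ℝ≥0 ↦ (∫ ω, (inverseProcess η s ω : ℝ) ^ p ∂P +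
        ∫ ω, ((inverseProcess η t ω : ℝ) ^ p -
          ((inverseProcess η t ω : ℝ) - inverseProcess η s ω) ^ p) ∂P) /
        (t : ℝ) ^ (α * max (p - 1) 0)) atTop (𝓝 k) := by
  have hms := hη.integral_rpow_pos hα1 hs hp
  have hm1 : 0 < ∫ ω, (inverseProcess η s ω : ℝ) ∂P := by
    simpa using hη.integral_rpow_pos hα1 hs zero_lt_one
  rcases lt_trichotomy p 1 with h | rfl | h
  · refine ⟨_, hms, ?_⟩
    rw [max_eq_right (by linarith)]
    simpa using (hη.tendsto_increment_of_lt_one s hp h).const_add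
      (∫ ω, (inverseProcess η s ω : ℝ) ^ p ∂P)
  · refine ⟨_, add_pos hm1 hm1, ?_⟩
    simp
  · refine ⟨_, mul_pos hp (mul_pos hm1 (hη.integral_rpow_pos hα1 one_pos (sub_pos.2 h))), ?_⟩
    rw [max_eq_left (by linarith)]
    have h0 := (tendsto_nnreal_coe_rpow_atTop (mul_pos hα0 (sub_pos.2 h))).const_div_atTop
      (∫ ω, (inverseProcess η s ω : ℝ) ^ p ∂P)
    simpa [add_div] using h0.add (hη.tendsto_increment_of_one_lt s h)

lemma IsStableSubordinator.integral_fbmCov (hη : IsStableSubordinator α η P) {H : ℝ}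
    (hH : 0 < H) {s t : ℝ≥0} (hst : s ≤ t) :
    ∫ ω, fbmCov H (inverseProcess η t ω) (inverseProcess η s ω) ∂P =
      (∫ ω, (inverseProcess η s ω : ℝ) ^ (2 * H) ∂P +
        ∫ ω, ((inverseProcess η t ω : ℝ) ^ (2 * H) -
          ((inverseProcess η t ω : ℝ) - inverseProcess η s ω) ^ (2 * H)) ∂P) / 2 := by
  have hp : 0 < 2 * H := by positivity
  have hint : Integrable (fun ω ↦ (inverseProcess η t ω : ℝ) ^ (2 * H) -
      ((inverseProcess η t ω : ℝ) - inverseProcess η s ω) ^ (2 * H)) P :=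
    (hη.integrable_rpow t hp).sub (hη.integrable_rpow_sub_rpow hst hp)
  rw [← integral_add (hη.integrable_rpow s hp) hint, ← integral_div]
  refine integral_congr_ae ?_
  filter_upwards [hη.ae_inverseProcess_le hst] with ω h
  rw [fbmCov, abs_sub_comm, abs_of_nonneg (sub_nonneg.2 h)]
  ring

end Asymptotics

/-! ### Long range dependence -/

theorem corollary2p11 {Ω : Type*} [MeasurableSpace Ω] (P : Measure Ω) [IsProbabilityMeasure P]
    (H : ℝ) (hH0 : 0 < H) (hH1 : H < 1) (α : ℝ) (hα0 : 0 < α) (hα1 : α < 1)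
    (B : ℝ≥0 → Ω → ℝ) (hB : IsFractionalBrownianMotion H B P)
    (η : ℝ≥0 → Ω → ℝ) (hη : IsStableSubordinator α η P)
    (hindep : IndepFun (fun ω t ↦ B t ω) (fun ω t ↦ inverseProcess η t ω) P) :
    HasLongRangeDependence (timeChange B (inverseProcess η)) P := by
  have hp : 0 < 2 * H := by positivity
  have hX := hB.timeChange_moments hH0 hη.aemeasurable_inverseProcess
    (fun t ↦ hη.integrable_rpow t hp) hindep
  have hsq : ∀ t, ∫ ω, timeChange B (inverseProcess η) t ω ^ 2 ∂P =
      ∫ ω, (inverseProcess η t ω : ℝ) ^ (2 * H) ∂P := by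
    intro t
    simp_rw [pow_two, (hX t t).2.2, fbmCov_self hH0]
  refine ⟨fun t ↦ (hX t t).1, fun t ↦ (hX t t).2.1, α * H - α * max (2 * H - 1) 0, ?_, ?_, ?_⟩
  · rw [← mul_sub]
    exact mul_pos hα0 (sub_pos.2 (max_lt (by linarith) hH0))
  · have h1 : 0 ≤ α * max (2 * H - 1) 0 := mul_nonneg hα0.le (le_max_right _ _)
    have h2 : α * H < 1 := by nlinarith
    linarith
  have hk : ∀ s : ℝ≥0, ∃ c : ℝ, 0 < s → c ≠ 0 ∧
      (fun t : ℝ≥0 ↦ corr (timeChange B (inverseProcess η) t)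
        (timeChange B (inverseProcess η) s) P) ~[atTop]
      fun t : ℝ≥0 ↦ c * (t : ℝ) ^ (-(α * H - α * max (2 * H - 1) 0)) := by
    intro s
    by_cases hs : 0 < s
    swap
    · exact ⟨0, fun h ↦ absurd h hs⟩
    obtain ⟨k, hk0, hk⟩ := hη.exists_tendsto_covariance hα0 hα1 hs hp
    have hm1 := hη.integral_rpow_pos hα1 one_pos hp
    have hms := hη.integral_rpow_pos hα1 hs hp
    set m1 := ∫ ω, (inverseProcess η 1 ω : ℝ) ^ (2 * H) ∂P
    set ms := ∫ ω, (inverseProcess η s ω : ℝ) ^ (2 * H) ∂P with hms_def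
    have hsqrt : 0 < √(m1 * ms) := Real.sqrt_pos.2 (mul_pos hm1 hms)
    refine ⟨k / (2 * √(m1 * ms)), fun _ ↦ ⟨by positivity, ?_⟩⟩
    have hlim := (isEquivalent_const_iff_tendsto (by positivity)).2
      (hk.div_const (2 * √(m1 * ms)))
    have hmul := hlim.mul (IsEquivalent.refl (l := atTop)
      (u := fun t : ℝ≥0 ↦ (t : ℝ) ^ (-(α * H - α * max (2 * H - 1) 0))))
    refine IsEquivalent.congr_left hmul ?_
    filter_upwards [eventually_ge_atTop s] with t ht
    have ht0 : 0 < t := hs.trans_le ht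
    have ht0' : (0 : ℝ) < t := by exact_mod_cast ht0
    have hroot : √((t : ℝ) ^ (α * (2 * H)) * m1 * ms) = (t : ℝ) ^ (α * H) * √(m1 * ms) := by
      rw [mul_assoc, Real.sqrt_mul (by positivity), Real.sqrt_eq_rpow, ← Real.rpow_mul ht0'.le]
      congr 2
      ring
    have hexp : (t : ℝ) ^ (-(α * H - α * max (2 * H - 1) 0)) =
        (t : ℝ) ^ (α * max (2 * H - 1) 0) / (t : ℝ) ^ (α * H) := by
      rw [← Real.rpow_sub ht0']
      congr 1
      ring
    have hcov := covariance_eq_sub (hX t t).1 (hX s s).1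
    rw [(hX t t).2.1, (hX s s).2.1] at hcov
    simp only [Pi.mul_apply, mul_zero, sub_zero] at hcov
    rw [(hX t s).2.2, hη.integral_fbmCov hH0 ht, ← hms_def] at hcov
    rw [corr, hcov, hsq, hsq, hη.integral_rpow_eq ht0, hroot]
    simp only [Pi.mul_apply]
    rw [hexp]
    have h1 : (0 : ℝ) < (t : ℝ) ^ (α * max (2 * H - 1) 0) := Real.rpow_pos_of_pos ht0' _
    have h2 : (0 : ℝ) < (t : ℝ) ^ (α * H) := Real.rpow_pos_of_pos ht0' _
    field_simp
  choose c hc using hk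
  exact ⟨c, fun s hs ↦ hc s hs⟩
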